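/- Let $\mathbf{A}$ be an algebra (a set $A$ with a family of finitary operations) that belongs to some congruence modular variety, i.e., $\mathbf{A}$ lies in an equationally defined class of algebras all of whose members have a modular congruence lattice. Assume that the congruence lattice $\mathrm{Con}(\mathbf{A})$ is of finite height, i.e., the lengths of its chains are bounded. Let $\mathbf{A}^{c}$ denote the algebra on the set $A$ whose fundamental operations are all finitary operations on $A$ that preserve every congruence of $\mathbf{A}$. Then $\mathbf{A}^{c}$ is solvable if and only if the two-element lattice $\mathbf{B}_2$ is not a homomorphic image of the lattice $\mathrm{Con}(\mathbf{A})$. Here, for congruences $\alpha,\beta$ of an algebra $\mathbf{B}$, the commutator $[\alpha,\beta]_{\mathbf{B}}$ is the intersection of all congruences $\delta$ of $\mathbf{B}$ such that for all $n\in\mathbb{N}$, all $(n+1)$-ary term functions $t$ of $\mathbf{B}$, all $(a,b)\in\alpha$ and all $(c_1,d_1),\dots,(c_n,d_n)\in\beta$ with $(t(a,c_1,\dots,c_n),t(a,d_1,\dots,d_n))\in\delta$, one has $(t(b,c_1,\dots,c_n),t(b,d_1,\dots,d_n))\in\delta$. The algebra $\mathbf{B}$ is solvable if, for the derived series defined by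 $\gamma_1=1_B$ (the total relation) and $\gamma_{m+1}=[\gamma_m,\gamma_m]_{\mathbf{B}}$, there is an $m\ge 1$ such that $\gamma_m=0_B$ (the equality relation). -/

import Mathlib

universe u v w

namespace UniversalAlgebra

/-- The finitary operation `f` on `A` preserves the binary relation `r`. -/
def Preserves {A : Type w} (r : A → A → Prop) {n : ℕ} (f : (Fin n → A) → A) : Prop :=
  ∀ x y : Fin n → A, (∀ i, r (x i) (y i)) → r (f x) (f y)

section

variable (L : FirstOrder.Language.{u, v}) (A : Type w) [L.Structure A]

/-- A congruence of the algebra `A`: an equivalence relation on `A` preserved by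
all fundamental operations. -/
structure Congruence extends Setoid A where
  preserves' : ∀ {n : ℕ} (f : L.Functions n),
    Preserves toSetoid.r (fun x : Fin n → A => FirstOrder.Language.Structure.funMap f x)

namespace Congruence

variable {L A}

/-- `θ.Rel a b` means that the pair `(a, b)` belongs to `θ`. -/
def Rel (θ : Congruence L A) (a b : A) : Prop := θ.toSetoid.r a b

theorem ext' {α β : Congruence L A} (h : ∀ a b, α.Rel a b ↔ β.Rel a b) : α = β := by
  cases α with
  | mk s hs =>
    cases β with
    | mk t ht =>
      have : s = t := Setoid.ext h
      subst this
      rfl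

/-- Congruences are ordered by inclusion. -/
instance : PartialOrder (Congruence L A) where
  le α β := ∀ a b, α.Rel a b → β.Rel a b
  le_refl _ _ _ h := h
  le_trans _ _ _ h₁ h₂ a b h := h₂ a b (h₁ a b h)
  le_antisymm _ _ h₁ h₂ := ext' fun a b => ⟨h₁ a b, h₂ a b⟩

theorem le_def {α β : Congruence L A} : α ≤ β ↔ ∀ a b, α.Rel a b → β.Rel a b := Iff.rfl

/-- The intersection of a set of congruences. -/
instance : InfSet (Congruence L A) where
  sInf S :=
    { r := fun a b => ∀ θ ∈ S, θ.Rel a b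
      iseqv :=
        ⟨fun a θ _ => θ.iseqv.refl a,
          fun h θ hθ => θ.iseqv.symm (h θ hθ),
          fun h₁ h₂ θ hθ => θ.iseqv.trans (h₁ θ hθ) (h₂ θ hθ)⟩
      preserves' := fun f x y h θ hθ => θ.preserves' f x y fun i => h i θ hθ }

/-- The total relation on `A`. -/
instance : Top (Congruence L A) where
  top :=
    { r := fun _ _ => True
      iseqv := ⟨fun _ => trivial, fun _ => trivial, fun _ _ => trivial⟩
      preserves' := fun _ _ _ _ => trivial }

/-- The equality relation on `A`. -/
instance : Bot (Congruence L A) where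
  bot :=
    { r := fun a b => a = b
      iseqv := ⟨fun _ => rfl, fun h => h.symm, fun h₁ h₂ => h₁.trans h₂⟩
      preserves' := fun _ x y h => by
        have : x = y := funext h
        subst this
        rfl }

/-- The intersection of two congruences. -/
instance : Min (Congruence L A) where
  min α β :=
    { r := fun a b => α.Rel a b ∧ β.Rel a b
      iseqv :=
        ⟨fun a => ⟨α.iseqv.refl a, β.iseqv.refl a⟩,
          fun h => ⟨α.iseqv.symm h.1, β.iseqv.symm h.2⟩,
          fun h₁ h₂ => ⟨α.iseqv.trans h₁.1 h₂.1, β.iseqv.trans h₁.2 h₂.2⟩⟩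
      preserves' := fun f x y h =>
        ⟨α.preserves' f x y fun i => (h i).1, β.preserves' f x y fun i => (h i).2⟩ }

/-- The congruence lattice `Con(A)`: a complete lattice under inclusion, with intersections
as meets; the join of a set is the least congruence containing all its members. -/
instance : CompleteLattice (Congruence L A) :=
  { completeLatticeOfInf (Congruence L A) (fun S =>
      ⟨fun θ hθ _ _ h => h θ hθ, fun _ hα a b h θ hθ => hα hθ a b h⟩) with
    inf := min
    inf_le_left := fun _ _ _ _ h => h.1
    inf_le_right := fun _ _ _ _ h => h.2
    le_inf := fun _ _ _ h₁ h₂ a b h => ⟨h₁ a b h, h₂ a b h⟩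
    top := ⊤
    le_top := fun _ _ _ _ => trivial
    bot := ⊥
    bot_le := fun θ a b h => by
      have : a = b := h
      subst this
      exact θ.iseqv.refl a }

/-- The term condition: `α` centralizes `β` modulo `δ`. -/
def Centralizes (α β δ : Congruence L A) : Prop :=
  ∀ (n : ℕ) (t : L.Term (Fin (n + 1))) (a b : A) (c d : Fin n → A),
    α.Rel a b → (∀ i, β.Rel (c i) (d i)) →
    δ.Rel (t.realize (Fin.cons a c : Fin (n + 1) → A))
      (t.realize (Fin.cons a d : Fin (n + 1) → A)) →
    δ.Rel (t.realize (Fin.cons b c : Fin (n + 1) → A))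
      (t.realize (Fin.cons b d : Fin (n + 1) → A))

/-- The term condition commutator `[α, β]`. -/
def commutator (α β : Congruence L A) : Congruence L A :=
  sInf {δ | Centralizes α β δ}

variable (L A) in
/-- The derived series of congruences of `A`, indexed from `0`. -/
def derivedSeries : ℕ → Congruence L A
  | 0 => ⊤
  | n + 1 => commutator (derivedSeries n) (derivedSeries n)

end Congruence

/-- The algebra `A` is solvable: its derived series reaches the equality relation. -/
def IsSolvableAlgebra : Prop :=
  ∃ m : ℕ, Congruence.derivedSeries L A m = ⊥

/-- The algebra `A` satisfies every identity `p.1 ≈ p.2` in `E`, that is, it belongs to the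
variety axiomatized by `E`. -/
def SatisfiesIdentities (E : Set (L.Term ℕ × L.Term ℕ)) : Prop :=
  ∀ p ∈ E, ∀ x : ℕ → A, p.1.realize x = p.2.realize x

/-- `A` belongs to a congruence modular variety: some set `E` of identities holds in `A`, and
every algebra satisfying `E` has a modular congruence lattice.  The members of the variety range
over a universe that contains copies of `A` and of all countably generated free algebras. -/
def InCongruenceModularVariety : Prop :=
  ∃ E : Set (L.Term ℕ × L.Term ℕ), SatisfiesIdentities L A E ∧
    ∀ (B : Type (max u w)) [L.Structure B], SatisfiesIdentities L B E →
      IsModularLattice (Congruence L B)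

/-- The signature with one `n`-ary operation symbol for each `n`-ary congruence preserving
operation of `A`. -/
def compLanguage : FirstOrder.Language.{w, 0} where
  Functions n := {f : (Fin n → A) → A // ∀ θ : Congruence L A, Preserves θ.Rel f}
  Relations _ := Empty

/-- The expansion of `A` by all its congruence preserving operations: the algebra on the
set `A` whose fundamental operations are all congruence preserving operations of `A`. -/
instance compStructure : (compLanguage L A).Structure A where
  funMap f x := f.1 x
  RelMap r := r.elim

end

end UniversalAlgebra

/-! Both directions use that `A` and its expansion Aᶜ have the same congruences
(`compCongruenceIso`).

If the two-element lattice is an image, finite height gives a least α sent to the top and a greatest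
β sent to the bottom, so every congruence is above α or below β. For (a, b) in α but not in β, some
congruence preserving operation acts on {a, b} as a meet. This forces α ≤ [α, α] in Aᶜ
(`le_commutator_of_splitting_pair`), and the derived series stays above α ≠ 0.

Conversely, modularity yields Day terms, which make the commutator symmetric and additive. If Aᶜ is
not solvable, its derived series stops at some γ = [γ, γ] ≠ 0. Let δ be a lower cover of γ. Sending
θ to the bottom exactly when [θ, γ] ≤ δ is a lattice homomorphism
(`exists_latticeHom_of_commutator_self`). -/

namespace UniversalAlgebra

open FirstOrder FirstOrder.Language Relation

/-! ### Joins of congruences as chains -/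

section Compatibility

/-- An operation that preserves a reflexive relation in each coordinate separately preserves
the reflexive transitive closure of that relation. -/
theorem preserves_reflTransGen {A : Type w} {R : A → A → Prop} {n : ℕ} {f : (Fin n → A) → A}
    (hf : ∀ (z : Fin n → A) (i : Fin n) (a b : A), R a b →
      R (f (Function.update z i a)) (f (Function.update z i b))) :
    Preserves (ReflTransGen R) f := by
  intro x y hxy
  have step : ∀ (z : Fin n → A) (i : Fin n) (a b : A), ReflTransGen R a b →
      ReflTransGen R (f (Function.update z i a)) (f (Function.update z i b)) := by
    intro z i a b hab
    induction hab with
    | refl => exact .refl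
    | tail _ h ih => exact ih.tail (hf z i _ _ h)
  have key : ∀ s : Finset (Fin n), ReflTransGen R (f x) (f (s.piecewise y x)) := by
    intro s
    induction s using Finset.induction_on with
    | empty => simpa using ReflTransGen.refl
    | insert j s hj ih =>
      refine ih.trans ?_
      have h := step (s.piecewise y x) j _ _ (hxy j)
      rw [Finset.piecewise_insert]
      have e : Function.update (s.piecewise y x) j (x j) = s.piecewise y x := by
        rw [Function.update_eq_self_iff]
        simp [hj]
      rwa [e] at h
  simpa using key Finset.univ

end Compatibility

section

variable {L : FirstOrder.Language.{u, v}} {A : Type w} [L.Structure A]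

namespace Congruence

theorem Rel.refl (θ : Congruence L A) (a : A) : θ.Rel a a := θ.iseqv.refl a

theorem Rel.symm {θ : Congruence L A} {a b : A} (h : θ.Rel a b) : θ.Rel b a := θ.iseqv.symm h

theorem Rel.trans {θ : Congruence L A} {a b c : A} (h : θ.Rel a b) (h' : θ.Rel b c) :
    θ.Rel a c := θ.iseqv.trans h h'

theorem Rel.realize {θ : Congruence L A} {V : Type*} (t : L.Term V) {x y : V → A}
    (h : ∀ i, θ.Rel (x i) (y i)) : θ.Rel (t.realize x) (t.realize y) := by
  induction t with
  | var i => exact h i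
  | func f ts ih => exact θ.preserves' f _ _ ih

/-- Two congruences are joined by alternating chains. -/
theorem sup_rel_iff {α β : Congruence L A} {a b : A} :
    (α ⊔ β).Rel a b ↔ ReflTransGen (fun x y => α.Rel x y ∨ β.Rel x y) a b := by
  constructor
  · let γ : Congruence L A :=
      { r := ReflTransGen (fun x y => α.Rel x y ∨ β.Rel x y)
        iseqv :=
          ⟨fun _ => .refl,
            fun h => by
              have : Std.Symm fun x y => α.Rel x y ∨ β.Rel x y :=
                ⟨fun _ _ h => h.imp Rel.symm Rel.symm⟩
              exact ReflTransGen.stdSymm.symm _ _ h,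
            fun h h' => h.trans h'⟩
        preserves' := fun f => preserves_reflTransGen fun z i a b h => by
          have aux : ∀ θ : Congruence L A, θ.Rel a b → ∀ j,
              θ.Rel (Function.update z i a j) (Function.update z i b j) := by
            intro θ h j
            by_cases hj : j = i
            · subst hj; simpa using h
            · simpa [hj] using Rel.refl θ (z j)
          exact h.imp (fun h => α.preserves' f _ _ (aux α h))
            (fun h => β.preserves' f _ _ (aux β h)) }
    have hα : α ≤ γ := fun _ _ h => ReflTransGen.single (Or.inl h)
    have hβ : β ≤ γ := fun _ _ h => ReflTransGen.single (Or.inr h)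
    exact fun h => (sup_le hα hβ : α ⊔ β ≤ γ) a b h
  · intro h
    induction h with
    | refl => exact Rel.refl _ _
    | tail _ h ih =>
      exact ih.trans (h.elim (le_sup_left (a := α) (b := β) _ _)
        (le_sup_right (a := α) (b := β) _ _))

/-! ### The term condition in terms of matrices -/

/-- `CommMatrix α β p q r s` says that the matrix with rows `p q` and `r s` lies in the
subalgebra of `A⁴` generated by the matrices that are constant along rows with `α`-related
columns, and those constant along columns with `β`-related rows. -/
inductive CommMatrix (α β : Congruence L A) : A → A → A → A → Prop
  | row {a b : A} : α.Rel a b → CommMatrix α β a a b b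
  | col {c d : A} : β.Rel c d → CommMatrix α β c d c d
  | app {n : ℕ} (f : L.Functions n) (p q r s : Fin n → A) :
      (∀ i, CommMatrix α β (p i) (q i) (r i) (s i)) →
      CommMatrix α β (Structure.funMap f p) (Structure.funMap f q)
        (Structure.funMap f r) (Structure.funMap f s)

namespace CommMatrix

variable {α β : Congruence L A} {p q r s : A}

theorem transpose (h : CommMatrix α β p q r s) : CommMatrix β α p r q s := by
  induction h with
  | row h => exact .col h
  | col h => exact .row h
  | app f p q r s _ ih => exact .app f p r q s ih

theorem rel_fst (h : CommMatrix α β p q r s) : α.Rel p r ∧ α.Rel q s := by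
  induction h with
  | row h => exact ⟨h, h⟩
  | col h => exact ⟨Rel.refl _ _, Rel.refl _ _⟩
  | app f p q r s _ ih =>
    exact ⟨α.preserves' f _ _ fun i => (ih i).1, α.preserves' f _ _ fun i => (ih i).2⟩

theorem rel_snd (h : CommMatrix α β p q r s) : β.Rel p q ∧ β.Rel r s :=
  h.transpose.rel_fst

theorem realize {V : Type*} (t : L.Term V) {p q r s : V → A}
    (h : ∀ i, CommMatrix α β (p i) (q i) (r i) (s i)) :
    CommMatrix α β (t.realize p) (t.realize q) (t.realize r) (t.realize s) := by
  induction t with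
  | var i => exact h i
  | func f ts ih => exact .app f _ _ _ _ ih

theorem swap (h : CommMatrix α β p q r s) : CommMatrix α β q p s r := by
  induction h with
  | row h => exact .row h
  | col h => exact .col h.symm
  | app f p q r s _ ih => exact .app f q p s r ih

/-- The related pairs themselves serve as variables, so one term produces all four entries. -/
theorem exists_term (h : CommMatrix α β p q r s) :
    ∃ t : L.Term ({x : A × A // α.Rel x.1 x.2} ⊕ {x : A × A // β.Rel x.1 x.2}),
      t.realize (Sum.elim (fun x => x.1.1) (fun x => x.1.1)) = p ∧
      t.realize (Sum.elim (fun x => x.1.1) (fun x => x.1.2)) = q ∧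
      t.realize (Sum.elim (fun x => x.1.2) (fun x => x.1.1)) = r ∧
      t.realize (Sum.elim (fun x => x.1.2) (fun x => x.1.2)) = s := by
  induction h with
  | row h => exact ⟨.var (.inl ⟨(_, _), h⟩), rfl, rfl, rfl, rfl⟩
  | col h => exact ⟨.var (.inr ⟨(_, _), h⟩), rfl, rfl, rfl, rfl⟩
  | app f p q r s _ ih =>
    choose t h₁ h₂ h₃ h₄ using ih
    refine ⟨.func f t, ?_, ?_, ?_, ?_⟩ <;> simp [*]

end CommMatrix

/-- A term in any set of variables is a term in finitely many variables. -/
theorem exists_fin_term {V : Type*} (t : L.Term V) :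
    ∃ (n : ℕ) (t' : L.Term (Fin n)) (φ : Fin n → V),
      ∀ x : V → A, t'.realize (x ∘ φ) = t.realize x := by
  classical
  refine ⟨t.varFinset.card, t.restrictVar t.varFinset.equivFin,
    fun i => (t.varFinset.equivFin.symm i).1, fun x => ?_⟩
  exact Term.realize_restrictVar _ (by simp)

theorem Centralizes.realize_update {α β δ : Congruence L A} (h : Centralizes α β δ)
    {V : Type*} [DecidableEq V] (t : L.Term V) (v : V) {a b : A} (c d : V → A) (hab : α.Rel a b)
    (hcd : ∀ i, β.Rel (c i) (d i))
    (h₀ : δ.Rel (t.realize (Function.update c v a)) (t.realize (Function.update d v a))) :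
    δ.Rel (t.realize (Function.update c v b)) (t.realize (Function.update d v b)) := by
  obtain ⟨n, t', φ, ht⟩ := exists_fin_term (A := A) t
  let t'' : L.Term (Fin (n + 1)) := t'.relabel fun i => if φ i = v then 0 else i.succ
  have key : ∀ (a : A) (c : V → A),
      t''.realize (Fin.cons a (c ∘ φ) : Fin (n + 1) → A) = t.realize (Function.update c v a) := by
    intro a c
    rw [← ht, Term.realize_relabel]
    congr 1
    funext i
    by_cases hi : φ i = v
    · simp [hi]
    · simp [hi]
  have := h n t'' a b (c ∘ φ) (d ∘ φ) hab (fun i => hcd _)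
  simp only [key] at this
  exact this h₀

/-- The term condition moves a single α-argument; a term has only finitely many, so they can be
moved one after another. -/
theorem centralizes_iff_commMatrix {α β δ : Congruence L A} :
    Centralizes α β δ ↔ ∀ p q r s, CommMatrix α β p q r s → δ.Rel p q → δ.Rel r s := by
  classical
  constructor
  · intro h p q r s hm hpq
    obtain ⟨t, rfl, rfl, rfl, rfl⟩ := hm.exists_term
    -- `e s` assigns second components to the α-variables in `s`, and first components to the rest.
    let e (s : Finset {x : A × A // α.Rel x.1 x.2}) (x : {x : A × A // α.Rel x.1 x.2}) : A :=
      if x ∈ s then x.1.2 else x.1.1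
    have key : ∀ s : Finset {x : A × A // α.Rel x.1 x.2},
        δ.Rel (t.realize (Sum.elim (e s) (fun x => x.1.1)))
          (t.realize (Sum.elim (e s) (fun x => x.1.2))) := by
      intro s
      induction s using Finset.induction_on with
      | empty => simpa [e] using hpq
      | insert j s hj ih =>
        have e₁ : ∀ g : {x : A × A // β.Rel x.1 x.2} → A,
            Function.update (Sum.elim (e s) g) (Sum.inl j) j.1.1 = Sum.elim (e s) g := by
          intro g
          rw [Function.update_eq_self_iff]
          simp [e, hj]
        have e₂ : ∀ g : {x : A × A // β.Rel x.1 x.2} → A,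
            Function.update (Sum.elim (e s) g) (Sum.inl j) j.1.2 =
              Sum.elim (e (insert j s)) g := by
          intro g
          funext i
          rcases i with i | i
          · by_cases hi : i = j
            · subst hi; simp [e]
            · simp [e, hi]
          · simp
        have := h.realize_update t (.inl j) (Sum.elim (e s) (fun x => x.1.1))
          (Sum.elim (e s) (fun x => x.1.2)) j.2 (by
            rintro (i | i)
            · exact Rel.refl _ _
            · exact i.2)
        rw [e₁, e₁, e₂, e₂] at this
        exact this ih
    have hs : ∀ g : {x : A × A // β.Rel x.1 x.2} → A,
        t.realize (Sum.elim (e t.varFinsetLeft) g) = t.realize (Sum.elim (fun x => x.1.2) g) := by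
      intro g
      have r := fun xs' h => Term.realize_restrictVarLeft (t := t) (f := id)
        (xs := Sum.elim (fun x => x.1.1.2) g) xs' h
      exact (r _ (by simp [e])).symm.trans (r _ (by simp))
    have := key t.varFinsetLeft
    rwa [hs, hs] at this
  · intro h n t a b c d hab hcd h₀
    refine h _ _ _ _ (CommMatrix.realize t fun i => ?_) h₀
    refine Fin.cases ?_ (fun i => ?_) i
    · exact .row hab
    · exact .col (hcd i)

theorem centralizes_inf (α β : Congruence L A) : Centralizes α β (α ⊓ β) := by
  rw [centralizes_iff_commMatrix]
  intro p q r s h hpq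
  exact ⟨(h.rel_fst.1.symm.trans hpq.1).trans h.rel_fst.2, h.rel_snd.2⟩

theorem commutator_le_inf (α β : Congruence L A) : commutator α β ≤ α ⊓ β :=
  sInf_le (centralizes_inf α β)

theorem Centralizes.mono {α α' β β' δ : Congruence L A} (hα : α ≤ α') (hβ : β ≤ β')
    (h : Centralizes α' β' δ) : Centralizes α β δ :=
  fun n t a b c d hab hcd => h n t a b c d (hα _ _ hab) fun i => hβ _ _ (hcd i)

theorem commutator_mono {α α' β β' : Congruence L A} (hα : α ≤ α') (hβ : β ≤ β') :
    commutator α β ≤ commutator α' β' :=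
  sInf_le_sInf fun _ h => Centralizes.mono hα hβ h

theorem Centralizes.sup_left {α α' β δ : Congruence L A} (h : Centralizes α β δ)
    (h' : Centralizes α' β δ) : Centralizes (α ⊔ α') β δ := by
  intro n t a b c d hab hcd h₀
  rw [sup_rel_iff] at hab
  induction hab with
  | refl => exact h₀
  | tail _ hs ih =>
    rcases hs with hs | hs
    · exact h n t _ _ c d hs hcd ih
    · exact h' n t _ _ c d hs hcd ih

end Congruence

/-! ### The commutator in the presence of Day terms -/

variable (L) in
/-- A quaternary term function that can occur in a sequence of Day terms. -/
structure IsDayTermFunction (m : (Fin 4 → A) → A) : Prop where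
  exists_term : ∃ t : L.Term (Fin 4), ∀ x : Fin 4 → A, t.realize x = m x
  idem : ∀ x y, m ![x, y, y, x] = x

variable (L) in
/-- Two quaternary term functions that can be consecutive in a sequence of Day terms. -/
def DayStep (m m' : (Fin 4 → A) → A) : Prop :=
  IsDayTermFunction L m ∧ IsDayTermFunction L m' ∧
    ((∀ x u, m ![x, x, u, u] = m' ![x, x, u, u]) ∨ ∀ x y u, m ![x, y, y, u] = m' ![x, y, y, u])

variable (L A) in
/-- The algebra `A` has Day terms. -/
def HasDayTerms : Prop :=
  ReflTransGen (DayStep L) (fun x : Fin 4 → A => x 0) (fun x : Fin 4 → A => x 3)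

namespace Congruence

theorem Rel.dayTermFunction {δ : Congruence L A} {m : (Fin 4 → A) → A}
    (hm : IsDayTermFunction L m) {x y z u x' y' z' u' : A} (hx : δ.Rel x x') (hy : δ.Rel y y')
    (hz : δ.Rel z z') (hu : δ.Rel u u') : δ.Rel (m ![x, y, z, u]) (m ![x', y', z', u']) := by
  obtain ⟨t, ht⟩ := hm.exists_term
  rw [← ht, ← ht]
  refine Rel.realize t fun i => ?_
  fin_cases i
  exacts [hx, hy, hz, hu]

/-- Apply `m` entrywise to four matrices; the identity m(x,y,y,x) = x collapses the first row to p,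
p. -/
theorem CommMatrix.dayTermFunction {α β : Congruence L A} {m : (Fin 4 → A) → A}
    (hm : IsDayTermFunction L m) {p q r s : A} (h : CommMatrix α β p q r s) :
    CommMatrix α β p p (m ![p, p, r, r]) (m ![p, q, s, r]) := by
  obtain ⟨t, ht⟩ := hm.exists_term
  have := CommMatrix.realize (α := α) (β := β) t (p := ![p, p, p, p]) (q := ![p, q, q, p])
    (r := ![p, p, r, r]) (s := ![p, q, s, r]) (by
      intro i
      fin_cases i
      exacts [.row (Rel.refl _ _), .col h.rel_snd.1, h, .row h.rel_fst.1])
  simpa only [ht, hm.idem] using this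

theorem Centralizes.dayTermFunction {α β δ : Congruence L A} (h : Centralizes α β δ)
    {m : (Fin 4 → A) → A} (hm : IsDayTermFunction L m) {p q r s : A}
    (hM : CommMatrix α β p q r s) : δ.Rel (m ![p, p, r, r]) (m ![p, q, s, r]) :=
  centralizes_iff_commMatrix.1 h _ _ _ _ (hM.dayTermFunction hm) (Rel.refl _ _)

/-- Along the Day sequence, p stays δ-related to m(p,p,r,r), which is r at the end. A step that only
knows m(x,y,y,u) detours through m(p,q,s,r), where q and s may be identified modulo δ. -/
theorem rel_of_dayTermFunction (hD : HasDayTerms L A) {δ : Congruence L A} {p q r s : A}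
    (hqs : δ.Rel q s)
    (h : ∀ m, IsDayTermFunction L m → δ.Rel (m ![p, p, r, r]) (m ![p, q, s, r])) :
    δ.Rel p r := by
  have key : ∀ m : (Fin 4 → A) → A, ReflTransGen (DayStep L) (fun x : Fin 4 → A => x 0) m →
      δ.Rel p (m ![p, p, r, r]) := by
    intro m hm
    induction hm with
    | refl => exact Rel.refl _ _
    | tail _ hs ih =>
      obtain ⟨h₁, h₂, h₃ | h₃⟩ := hs
      · rwa [← h₃]
      · refine (ih.trans (h _ h₁)).trans (Rel.trans ?_ (h _ h₂).symm)
        have e₁ := Rel.dayTermFunction h₁ (Rel.refl δ p) (Rel.refl δ q) hqs.symm (Rel.refl δ r)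
        have e₂ := Rel.dayTermFunction h₂ (Rel.refl δ p) (Rel.refl δ q) hqs (Rel.refl δ r)
        rw [h₃] at e₁
        exact e₁.trans e₂
  exact key _ hD

/-- With `Centralizes.dayTermFunction`, this reduces centrality to δ containing certain pairs, a
condition stable under enlarging and intersecting δ. Transposing the matrix interchanges α and β. -/
theorem centralizes_of_dayTermFunction (hD : HasDayTerms L A) {α β δ : Congruence L A}
    (h : ∀ m, IsDayTermFunction L m → ∀ p q r s, CommMatrix α β p q r s →
      δ.Rel (m ![p, p, r, r]) (m ![p, q, s, r])) : Centralizes β α δ := by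
  rw [centralizes_iff_commMatrix]
  intro p q r s hM hpq
  exact rel_of_dayTermFunction hD (p := r) (q := p) (r := s) (s := q) hpq
    fun m hm => h m hm _ _ _ _ hM.transpose.swap

theorem Centralizes.mono_right (hD : HasDayTerms L A) {α β δ δ' : Congruence L A}
    (hδ : δ ≤ δ') (h : Centralizes α β δ) : Centralizes β α δ' :=
  centralizes_of_dayTermFunction hD fun _ hm _ _ _ _ hM => hδ _ _ (h.dayTermFunction hm hM)

theorem centralizes_commutator (hD : HasDayTerms L A) (α β : Congruence L A) :
    Centralizes α β (commutator α β) := by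
  refine Centralizes.mono_right hD le_rfl (centralizes_of_dayTermFunction hD ?_)
  exact fun m hm p q r s hM δ (hδ : Centralizes α β δ) => hδ.dayTermFunction hm hM

theorem commutator_le_iff (hD : HasDayTerms L A) {α β δ : Congruence L A} :
    commutator α β ≤ δ ↔ Centralizes α β δ :=
  -- Each use of `mono_right` interchanges α and β, so a second use restores the order.
  ⟨fun h => ((centralizes_commutator hD α β).mono_right hD h).mono_right hD le_rfl,
    fun h => sInf_le h⟩

theorem commutator_comm (hD : HasDayTerms L A) (α β : Congruence L A) :
    commutator α β = commutator β α :=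
  le_antisymm ((commutator_le_iff hD).2 ((centralizes_commutator hD β α).mono_right hD le_rfl))
    ((commutator_le_iff hD).2 ((centralizes_commutator hD α β).mono_right hD le_rfl))

theorem commutator_sup_le (hD : HasDayTerms L A) {α α' β δ : Congruence L A}
    (h : commutator α β ≤ δ) (h' : commutator α' β ≤ δ) : commutator (α ⊔ α') β ≤ δ :=
  (commutator_le_iff hD).2
    (((commutator_le_iff hD).1 h).sup_left ((commutator_le_iff hD).1 h'))

/-! ### From non-solvability to a homomorphism onto two elements -/

/-- A congruence `γ` that equals its own commutator and has a lower cover `δ` yields a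
homomorphism onto the two-element lattice: the congruences centralizing `γ` modulo `δ` go
to `false`. -/
theorem exists_latticeHom_of_commutator_self (hD : HasDayTerms L A) {γ δ : Congruence L A}
    (hγ : commutator γ γ = γ) (hδ : δ ⋖ γ) :
    ∃ h : LatticeHom (Congruence L A) Bool, Function.Surjective h := by
  classical
  have mono : ∀ {θ θ' : Congruence L A}, θ ≤ θ' → commutator θ' γ ≤ δ → commutator θ γ ≤ δ :=
    fun h h' => (commutator_mono h le_rfl).trans h'
  have le_left : ∀ α β : Congruence L A, commutator α β ≤ α :=
    fun α β => (commutator_le_inf α β).trans inf_le_left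
  have le_right : ∀ α β : Congruence L A, commutator α β ≤ β :=
    fun α β => (commutator_le_inf α β).trans inf_le_right
  have hγδ : ¬ commutator γ γ ≤ δ := by
    rw [hγ]
    exact hδ.lt.not_ge
  have sup_eq : ∀ {θ : Congruence L A}, θ ≤ γ → ¬ θ ≤ δ → θ ⊔ δ = γ := fun {θ} h h' =>
    (hδ.eq_or_eq le_sup_right (sup_le h hδ.le)).resolve_left fun e => h' (e ▸ le_sup_left)
  have inf : ∀ {θ₁ θ₂ : Congruence L A}, commutator (θ₁ ⊓ θ₂) γ ≤ δ →
      commutator θ₁ γ ≤ δ ∨ commutator θ₂ γ ≤ δ := by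
    intro θ₁ θ₂ h
    by_contra! hn
    have e₁ := sup_eq (le_right θ₁ γ) hn.1
    have e₂ := sup_eq (le_right θ₂ γ) hn.2
    -- Both [θᵢ, γ] join with δ to γ, so additivity would give [γ, γ] ≤ δ.
    have key : ¬ commutator (commutator θ₁ γ) (commutator θ₂ γ) ≤ δ := by
      intro hle
      apply hγδ
      have h₁ : commutator γ (commutator θ₂ γ) ≤ δ := by
        have := commutator_sup_le hD hle (le_left δ _)
        rwa [e₁] at this
      rw [commutator_comm hD] at h₁
      have h₂ := commutator_sup_le hD h₁ (le_left δ γ)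
      rwa [e₂] at h₂
    -- The double commutator lies below θ₁ ⊓ θ₂ and also joins with δ to γ, which again forces [γ,
    -- γ] ≤ δ.
    have e₃ := sup_eq ((le_left _ _).trans (le_right _ _)) key
    apply hγδ
    have hle := commutator_le_inf (commutator θ₁ γ) (commutator θ₂ γ)
    have h₃ := commutator_sup_le hD
      (mono (hle.trans (inf_le_inf (le_left θ₁ γ) (le_left θ₂ γ))) h) (le_left δ γ)
    rwa [e₃] at h₃
  refine ⟨{ toFun := fun θ => !decide (commutator θ γ ≤ δ), map_sup' := ?_, map_inf' := ?_ }, ?_⟩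
  · intro θ₁ θ₂
    have : commutator (θ₁ ⊔ θ₂) γ ≤ δ ↔ commutator θ₁ γ ≤ δ ∧ commutator θ₂ γ ≤ δ :=
      ⟨fun h => ⟨mono le_sup_left h, mono le_sup_right h⟩, fun h => commutator_sup_le hD h.1 h.2⟩
    simp [this]
  · intro θ₁ θ₂
    have : commutator (θ₁ ⊓ θ₂) γ ≤ δ ↔ commutator θ₁ γ ≤ δ ∨ commutator θ₂ γ ≤ δ :=
      ⟨inf, fun h => h.elim (mono inf_le_left) (mono inf_le_right)⟩
    simp [this]
  · rintro (_ | _)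
    · exact ⟨⊥, by simpa using (le_left ⊥ γ).trans bot_le⟩
    · exact ⟨γ, by simpa using hγδ⟩

theorem exists_commutator_self_of_not_isSolvable [WellFoundedLT (Congruence L A)]
    (h : ¬ IsSolvableAlgebra L A) : ∃ γ : Congruence L A, γ ≠ ⊥ ∧ commutator γ γ = γ := by
  obtain ⟨_, ⟨m, rfl⟩, hm⟩ := wellFounded_lt.has_min (Set.range (derivedSeries L A)) ⟨_, 0, rfl⟩
  refine ⟨derivedSeries L A m, fun e => h ⟨m, e⟩, ?_⟩
  exact eq_of_le_of_not_lt ((commutator_le_inf _ _).trans inf_le_left) (hm _ ⟨m + 1, rfl⟩)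

theorem exists_latticeHom_of_not_isSolvable (hD : HasDayTerms L A)
    [WellFoundedLT (Congruence L A)] [WellFoundedGT (Congruence L A)]
    (h : ¬ IsSolvableAlgebra L A) :
    ∃ h : LatticeHom (Congruence L A) Bool, Function.Surjective h := by
  obtain ⟨γ, hγ, hγγ⟩ := exists_commutator_self_of_not_isSolvable h
  obtain ⟨δ, hδ, hmax⟩ := wellFounded_gt.has_min (Set.Iio γ) ⟨⊥, bot_lt_iff_ne_bot.2 hγ⟩
  exact exists_latticeHom_of_commutator_self hD hγγ ⟨hδ, fun ε h₁ h₂ => hmax ε h₂ h₁⟩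

end Congruence
end

/-! ### Day terms from modularity -/

section DayTerms

variable (L : FirstOrder.Language.{u, v}) (A : Type w) [L.Structure A]

/-- The quaternary term functions of `A`. -/
def TermFunction₄ : Type (max u w) :=
  ULift.{u} {f : (Fin 4 → A) → A // ∃ t : L.Term (Fin 4), ∀ x : Fin 4 → A, t.realize x = f x}

instance : L.Structure (TermFunction₄ L A) where
  funMap f g := ⟨fun x => Structure.funMap f fun i => (g i).down.1 x, by
    choose t ht using fun i => (g i).down.2
    exact ⟨.func f t, fun x => by simp [ht]⟩⟩
  RelMap _ _ := False

variable {L A}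

namespace TermFunction₄

theorem realize_apply {V : Type*} (t : L.Term V) (g : V → TermFunction₄ L A) (x : Fin 4 → A) :
    (t.realize g).down.1 x = t.realize fun i => (g i).down.1 x := by
  induction t with
  | var i => rfl
  | func f ts ih =>
    simp only [Term.realize_func, ← ih]
    rfl

theorem satisfiesIdentities {E : Set (L.Term ℕ × L.Term ℕ)} (h : SatisfiesIdentities L A E) :
    SatisfiesIdentities L (TermFunction₄ L A) E := by
  refine fun p hp g => ULift.ext _ _ (Subtype.ext (funext fun x => ?_))
  rw [realize_apply, realize_apply]
  exact h p hp _

/-- Agreement of quaternary term functions on a set of arguments. -/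
def agree (S : Set (Fin 4 → A)) : Congruence L (TermFunction₄ L A) where
  r f g := ∀ x ∈ S, f.down.1 x = g.down.1 x
  iseqv := ⟨fun _ _ _ => rfl, fun h x hx => (h x hx).symm,
    fun h h' x hx => (h x hx).trans (h' x hx)⟩
  preserves' f _ _ h x hx := congrArg (Structure.funMap f) (funext fun i => h i x hx)

variable (L) in
/-- The projections. -/
def proj (i : Fin 4) : TermFunction₄ L A := ⟨fun x => x i, .var i, fun _ => rfl⟩

end TermFunction₄

-- The projections satisfy 0 ψ 1 φ 2 ψ 3 and 0 θ 3. As φ ≤ θ, modularity puts (0, 3) into φ ⊔ (ψ ⊓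
-- θ), and a chain witnessing this is a sequence of Day terms.
open TermFunction₄ in
theorem hasDayTerms_of_isModularLattice [IsModularLattice (Congruence L (TermFunction₄ L A))] :
    HasDayTerms L A := by
  let θ : Congruence L (TermFunction₄ L A) := agree {x | ∃ a b, x = ![a, b, b, a]}
  let φ : Congruence L (TermFunction₄ L A) := agree {x | ∃ a b c, x = ![a, b, b, c]}
  let ψ : Congruence L (TermFunction₄ L A) := agree {x | ∃ a c, x = ![a, a, c, c]}
  have hφθ : φ ≤ θ := by
    rintro f g h _ ⟨a, b, rfl⟩
    exact h _ ⟨a, b, a, rfl⟩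
  have h₀ : ((φ ⊔ ψ) ⊓ θ).Rel (proj L 0) (proj L 3) := by
    have hψ := le_sup_right (a := φ) (b := ψ)
    have hφ := le_sup_left (a := φ) (b := ψ)
    refine ⟨(hψ _ (proj L 1) ?_).trans ((hφ _ (proj L 2) ?_).trans (hψ _ _ ?_)), ?_⟩
    · rintro _ ⟨a, c, rfl⟩; rfl
    · rintro _ ⟨a, b, c, rfl⟩; rfl
    · rintro _ ⟨a, c, rfl⟩; rfl
    · rintro _ ⟨a, b, rfl⟩; rfl
  have h₁ := Congruence.sup_rel_iff.1 (sup_inf_le_assoc_of_le ψ hφθ _ _ h₀)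
  have key : ∀ f : TermFunction₄ L A,
      ReflTransGen (fun f g => φ.Rel f g ∨ (ψ ⊓ θ).Rel f g) (proj L 0) f →
      θ.Rel (proj L 0) f ∧ ReflTransGen (DayStep L) (fun x : Fin 4 → A => x 0) f.down.1 := by
    have day : ∀ f : TermFunction₄ L A, θ.Rel (proj L 0) f → IsDayTermFunction L f.down.1 :=
      fun f hf => ⟨f.down.2, fun x y => (hf _ ⟨x, y, rfl⟩).symm⟩
    intro f hf
    induction hf with
    | refl => exact ⟨Congruence.Rel.refl _ _, .refl⟩
    | @tail f g _ h ih =>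
      have hg : θ.Rel (proj L 0) g := ih.1.trans (h.elim (hφθ _ _) And.right)
      refine ⟨hg, ih.2.tail ⟨day _ ih.1, day _ hg, ?_⟩⟩
      rcases h with h | h
      · exact Or.inr fun x y u => h _ ⟨x, y, u, rfl⟩
      · exact Or.inl fun x u => h.1 _ ⟨x, u, rfl⟩
  exact (key _ h₁).2

theorem InCongruenceModularVariety.hasDayTerms (h : InCongruenceModularVariety L A) :
    HasDayTerms L A := by
  obtain ⟨E, hE, hmod⟩ := h
  have := hmod (TermFunction₄ L A) (TermFunction₄.satisfiesIdentities hE)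
  exact hasDayTerms_of_isModularLattice

end DayTerms

/-! ### Congruence preserving operations and splitting pairs -/

section CompatibleOperations

variable {L : FirstOrder.Language.{u, v}} {A : Type w} [L.Structure A]

/-- A congruence preserving operation of `A`, as a term of the expansion of `A`. -/
def preservingTerm {n : ℕ} (f : (Fin n → A) → A)
    (hf : ∀ θ : Congruence L A, Preserves θ.Rel f) : (compLanguage L A).Term (Fin n) :=
  .func (show (compLanguage L A).Functions n from ⟨f, hf⟩) .var

theorem realize_preservingTerm {n : ℕ} {f : (Fin n → A) → A}
    (hf : ∀ θ : Congruence L A, Preserves θ.Rel f) (x : Fin n → A) :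
    (preservingTerm f hf).realize x = f x :=
  rfl

theorem HasDayTerms.compLanguage (h : HasDayTerms L A) : HasDayTerms (compLanguage L A) A := by
  have day : ∀ m : (Fin 4 → A) → A, IsDayTermFunction L m →
      IsDayTermFunction (UniversalAlgebra.compLanguage L A) m := by
    rintro m ⟨⟨t, ht⟩, hm⟩
    refine ⟨⟨preservingTerm m fun θ x y hxy => ?_, realize_preservingTerm _⟩, hm⟩
    rw [← ht, ← ht]
    exact Congruence.Rel.realize t hxy
  exact ReflTransGen.mono (fun m m' hm => ⟨day _ hm.1, day _ hm.2.1, hm.2.2⟩) _ _ h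

variable (L A) in
/-- The congruences of `A` are those of its expansion by all congruence preserving
operations. -/
def compCongruenceIso : Congruence L A ≃o Congruence (compLanguage L A) A where
  toFun θ := { θ.toSetoid with preserves' := fun f => f.2 θ }
  invFun θ :=
    { θ.toSetoid with
      preserves' := fun f =>
        θ.preserves' (n := _) ⟨Structure.funMap f, fun η => η.preserves' f⟩ }
  left_inv _ := rfl
  right_inv _ := rfl
  map_rel_iff' := Iff.rfl

/-- A lattice homomorphism onto the two-element lattice determines a splitting pair. -/
theorem exists_splitting_pair {C : Type*} [Lattice C] [WellFoundedLT C] [WellFoundedGT C]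
    {h : LatticeHom C Bool} (hs : Function.Surjective h) :
    ∃ a b : C, ¬ a ≤ b ∧ ∀ c, a ≤ c ∨ c ≤ b := by
  obtain ⟨a, ha, hmin⟩ := wellFounded_lt.has_min {c | h c = true} (hs true)
  obtain ⟨b, hb, hmax⟩ := wellFounded_gt.has_min {c | h c = false} (hs false)
  simp only [Set.mem_ofPred_eq] at ha hb hmin hmax
  refine ⟨a, b, fun hab => ?_, fun c => ?_⟩
  · have := OrderHomClass.mono h hab
    rw [ha, hb] at this
    exact absurd this (by decide)
  · rcases hc : h c
    · right
      by_contra hcb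
      exact hmax (b ⊔ c) (by simp [hb, hc]) (left_lt_sup.2 hcb)
    · left
      by_contra hac
      exact hmin (a ⊓ c) (by simp [ha, hc]) (inf_lt_left.2 hac)

/-- If every congruence is above `α` or below `β`, then every pair in `α` but not in `β` lies
in the commutator of `α` with itself in the algebra of congruence preserving operations. -/
theorem le_commutator_of_splitting_pair {α β : Congruence L A}
    (h : ∀ θ, α ≤ θ ∨ θ ≤ β) (hαβ : ¬ α ≤ β) :
    compCongruenceIso L A α ≤
      Congruence.commutator (compCongruenceIso L A α) (compCongruenceIso L A α) := by
  classical
  refine le_sInf fun δ' hδ => ?_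
  obtain ⟨δ, rfl⟩ := (compCongruenceIso L A).surjective δ'
  rw [OrderIso.le_iff_le]
  refine (h δ).resolve_right fun hle => ?_
  simp only [Congruence.le_def, not_forall] at hαβ
  obtain ⟨a, b, hα, hβ⟩ := hαβ
  -- On {a, b} this is a meet with b on top. Its values are α-related, and its case distinction
  -- depends only on β-classes; hence it preserves congruences above α and those below β.
  let f : (Fin 2 → A) → A := fun x => if ∀ i, β.Rel (x i) b then b else a
  have hf : ∀ θ : Congruence L A, Preserves θ.Rel f := by
    intro θ x y hxy
    rcases h θ with hθ | hθ
    · refine hθ _ _ ?_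
      simp only [f]
      split_ifs
      exacts [Congruence.Rel.refl _ _, hα.symm, hα, Congruence.Rel.refl _ _]
    · have : (∀ i, β.Rel (x i) b) ↔ ∀ i, β.Rel (y i) b :=
        forall_congr' fun i => ⟨(hθ _ _ (hxy i)).symm.trans, (hθ _ _ (hxy i)).trans⟩
      simp only [f, this]
      exact Congruence.Rel.refl _ _
  -- Since f(a,a) = f(a,b), centrality relates f(b,a) = a to f(b,b) = b modulo δ ≤ β.
  have hab := hδ 1 (preservingTerm f hf) a b (fun _ => a) (fun _ => b) hα fun _ => hα
  have value : ∀ x y : A, (preservingTerm f hf).realize (Fin.cons x fun _ => y : Fin 2 → A) =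
      if β.Rel x b ∧ β.Rel y b then b else a := by
    intro x y
    simp [realize_preservingTerm, f, Fin.forall_fin_two]
  rw [value, value, value, value, if_neg fun h => hβ h.1, if_neg fun h => hβ h.1,
    if_neg fun h => hβ h.2, if_pos ⟨Congruence.Rel.refl _ _, Congruence.Rel.refl _ _⟩] at hab
  exact hβ (hle _ _ (hab (Congruence.Rel.refl _ _)))

theorem not_isSolvable_of_splitting_pair {α β : Congruence L A}
    (h : ∀ θ, α ≤ θ ∨ θ ≤ β) (hαβ : ¬ α ≤ β) : ¬ IsSolvableAlgebra (compLanguage L A) A := by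
  rintro ⟨m, hm⟩
  have key : ∀ m, compCongruenceIso L A α ≤ Congruence.derivedSeries (compLanguage L A) A m := by
    intro m
    induction m with
    | zero => exact le_top
    | succ m ih =>
      exact (le_commutator_of_splitting_pair h hαβ).trans (Congruence.commutator_mono ih ih)
  have := key m
  rw [hm, le_bot_iff, map_eq_bot_iff] at this
  exact hαβ (this ▸ bot_le)

end CompatibleOperations

end UniversalAlgebra

/-! ### The characterization of solvability -/

theorem mainTheorem11 (L : FirstOrder.Language.{u, v}) [L.IsAlgebraic]
    (A : Type w) [L.Structure A]
    (hA : UniversalAlgebra.InCongruenceModularVariety L A)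
    (hfin : FiniteDimensionalOrder (UniversalAlgebra.Congruence L A)) :
    UniversalAlgebra.IsSolvableAlgebra (UniversalAlgebra.compLanguage L A) A ↔
      ¬ ∃ h : LatticeHom (UniversalAlgebra.Congruence L A) Bool, Function.Surjective h := by
  open UniversalAlgebra in
  have hlt : WellFoundedLT (Congruence L A) :=
    ⟨SetRel.IsWellFounded.of_finiteDimensional {(a, b) : Congruence L A × Congruence L A | a < b}⟩
  have hgt : WellFoundedGT (Congruence L A) :=
    ⟨SetRel.IsWellFounded.inv_of_finiteDimensional
      {(a, b) : Congruence L A × Congruence L A | a < b}⟩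
  constructor
  · rintro hs ⟨h, hh⟩
    obtain ⟨α, β, hαβ, hsplit⟩ := exists_splitting_pair hh
    exact not_isSolvable_of_splitting_pair hsplit hαβ hs
  · intro hn
    by_contra hs
    let e := compCongruenceIso L A
    have : WellFoundedLT (Congruence (compLanguage L A) A) :=
      ⟨e.symm.toRelIsoLT.toRelEmbedding.wellFounded hlt.wf⟩
    have : WellFoundedGT (Congruence (compLanguage L A) A) :=
      ⟨e.symm.toRelIsoLT.toRelEmbedding.swap.wellFounded hgt.wf⟩
    obtain ⟨h, hh⟩ :=
      Congruence.exists_latticeHom_of_not_isSolvable hA.hasDayTerms.compLanguage hs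
    exact hn ⟨h.comp ⟨⟨e, map_sup e⟩, map_inf e⟩, hh.comp e.surjective⟩
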